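/- Let $k$ be a field, $Q$ a finite quiver and $\Lambda = kQ/I$ a bound quiver algebra, i.e. $I$ is an admissible ideal of the path algebra $kQ$. For $A \subseteq Q_1$ every $z \in kQ$ is uniquely $z = z_A + z_{\nmid A}$, where $z_A$ is a linear combination of paths passing through some arrow of $A$ and $z_{\nmid A}$ one of paths avoiding all arrows of $A$. Let $\langle A+I\rangle$ be the ideal of $\Lambda$ generated by the arrows in $A$. The set $A$ (possibly empty) is *pre-removable* in $\Lambda$ if $z_A, z_{\nmid A} \in I$ for all $z \in I$. A pre-removable $A$ is *removable* in $\Lambda$ if either $\langle A+I\rangle$ has finite projective dimension both as a left and as a right $\Lambda$-module, or $\langle A+I\rangle^2 = 0$ and $\langle A+I\rangle$ has finite projective dimension only as a right $\Lambda$-module (paths are multiplied from left to right: $pq$ is $p$ followed by $q$). If $A$ is pre-removable, the *canonical representation* of $\Lambda/\langle A+I\rangle$ is $kQ'/I'$, where $Q'$ is obtained from $Q$ by deleting the arrows in $A$ and $I'$ is the intersection of $I$ with the span of the paths avoiding $A$. The set $A$ is *eventually removable* in $\Lambda$ if it has an ordered partition $A = A_1 \,\dot\cup\, \cdots \,\dot\cup\,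 A_m$ such that, for every $j = 1, \dots, m$, the set $A_j$ is removable in the canonical representation of $\Lambda/\langle (A_1 \cup \dots \cup A_{j-1}) + I\rangle$. **Proposition.** For every bound quiver algebra $\Lambda = kQ/I$ there exists a unique maximal (with respect to inclusion) eventually removable set of arrows $A^{\mathrm{er}}_\Lambda$. Hence the *arrow reduced version* $\Lambda_{\mathrm{ARV}}$, the canonical representation of $\Lambda/\langle A^{\mathrm{er}}_\Lambda + I\rangle$, is well defined: $A^{\mathrm{er}}_\Lambda$ is pre-removable in $\Lambda$, the corresponding ideal $I'$ of $kQ'$ is admissible, and sending the class of each path of $Q'$ to its class induces an isomorphism of $k$-algebras $kQ'/I' \cong \Lambda/\langle A^{\mathrm{er}}_\Lambda + I\rangle$. -/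

import Mathlib

open Quiver CategoryTheory

universe u v w

noncomputable section

namespace BoundQuiver

/-- The paths of a quiver (of arbitrary length, including the trivial paths), bundled with their
source and target. -/
abbrev QPath (V : Type v) [Quiver.{w + 1} V] : Type (max v (w + 1)) :=
  Σ a b : V, Quiver.Path a b

/-- The path algebra `k Q` of a quiver: the vector space on the basis of all paths. -/
def PathAlgebra (k : Type u) [Field k] (V : Type v) [Quiver.{w + 1} V] : Type (max u v (w + 1)) :=
  QPath V →₀ k

namespace PathAlgebra

variable {k : Type u} [Field k] {V : Type v} [Quiver.{w + 1} V]

instance : AddCommGroup (PathAlgebra k V) := inferInstanceAs (AddCommGroup (QPath V →₀ k))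

instance : Module k (PathAlgebra k V) := inferInstanceAs (Module k (QPath V →₀ k))

/-- The coefficients of an element of the path algebra. -/
def coeffs : PathAlgebra k V ≃ₗ[k] (QPath V →₀ k) := LinearEquiv.refl k (QPath V →₀ k)

/-- The basis element of the path algebra given by a path. -/
def ofPath (p : QPath V) : PathAlgebra k V := coeffs.symm (Finsupp.single p 1)

/-- The linear map out of the path algebra with prescribed values on the paths. -/
def lift {M : Type*} [AddCommMonoid M] [Module k M] (f : QPath V → M) : PathAlgebra k V →ₗ[k] M :=
  Finsupp.linearCombination k f ∘ₗ coeffs.toLinearMap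

@[simp]
theorem lift_ofPath {M : Type*} [AddCommMonoid M] [Module k M] (f : QPath V → M) (p : QPath V) :
    lift f (ofPath p : PathAlgebra k V) = f p := by
  simp [lift, ofPath]

open Classical in
/-- The product of two paths: the concatenation `p q` (first `p`, then `q`) if `p` ends where `q`
starts, and zero otherwise. -/
def pathMul (p q : QPath V) : PathAlgebra k V :=
  if h : q.1 = p.2.1 then ofPath ⟨p.1, q.2.1, p.2.2.comp (q.2.2.cast h rfl)⟩ else 0

/-- The bilinear extension of the product of paths. -/
def mulLin : PathAlgebra k V →ₗ[k] PathAlgebra k V →ₗ[k] PathAlgebra k V :=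
  lift fun p => lift (pathMul p)

instance : Mul (PathAlgebra k V) := ⟨fun x y => mulLin x y⟩

theorem mul_def (x y : PathAlgebra k V) : x * y = mulLin x y := rfl

instance : NonUnitalNonAssocRing (PathAlgebra k V) where
  left_distrib x y z := map_add (mulLin x) y z
  right_distrib x y z := LinearMap.map_add₂ mulLin x y z
  zero_mul x := LinearMap.map_zero₂ mulLin x
  mul_zero x := map_zero (mulLin x)

theorem ofPath_mul_ofPath (p q : QPath V) :
    (ofPath p * ofPath q : PathAlgebra k V) = pathMul p q := by
  rw [mul_def, mulLin, lift_ofPath, lift_ofPath]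

theorem ofPath_comp {a b c : V} (p : Quiver.Path a b) (q : Quiver.Path b c) :
    (ofPath ⟨a, b, p⟩ * ofPath ⟨b, c, q⟩ : PathAlgebra k V) = ofPath ⟨a, c, p.comp q⟩ := by
  rw [ofPath_mul_ofPath, pathMul, dif_pos rfl]
  rfl

theorem ofPath_mul_ne {a b c d : V} (p : Quiver.Path a b) (q : Quiver.Path c d) (h : c ≠ b) :
    (ofPath ⟨a, b, p⟩ * ofPath ⟨c, d, q⟩ : PathAlgebra k V) = 0 := by
  rw [ofPath_mul_ofPath, pathMul, dif_neg h]

theorem smul_mul (c : k) (x y : PathAlgebra k V) : c • x * y = c • (x * y) :=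
  LinearMap.map_smul₂ mulLin c x y

theorem mul_smul' (c : k) (x y : PathAlgebra k V) : x * c • y = c • (x * y) :=
  map_smul (mulLin x) c y

theorem induction_on {P : PathAlgebra k V → Prop} (x : PathAlgebra k V) (zero : P 0)
    (add : ∀ x y, P x → P y → P (x + y)) (smul : ∀ (c : k) (p : QPath V), P (c • ofPath p)) :
    P x := by
  have key : ∀ f : QPath V →₀ k, P (coeffs.symm f) := by
    intro f
    induction f using Finsupp.induction_linear with
    | zero => rw [map_zero]; exact zero
    | add f g hf hg => rw [map_add]; exact add _ _ hf hg
    | single p c =>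
      have h : coeffs.symm (Finsupp.single p c) = c • (ofPath p : PathAlgebra k V) := by
        rw [ofPath, ← map_smul, Finsupp.smul_single, smul_eq_mul, mul_one]
      rw [h]; exact smul c p
  simpa using key (coeffs x)

theorem ofPath_assoc (p q r : QPath V) :
    (ofPath p * ofPath q * ofPath r : PathAlgebra k V) = ofPath p * (ofPath q * ofPath r) := by
  obtain ⟨a, b, p⟩ := p
  obtain ⟨c, d, q⟩ := q
  obtain ⟨e, f, r⟩ := r
  by_cases h1 : c = b
  · subst h1
    by_cases h2 : e = d
    · subst h2
      simp only [ofPath_comp, Quiver.Path.comp_assoc]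
    · rw [ofPath_mul_ne q r h2, mul_zero, ofPath_comp, ofPath_mul_ne _ _ h2]
  · rw [ofPath_mul_ne p q h1, zero_mul]
    by_cases h2 : e = d
    · subst h2
      rw [ofPath_comp, ofPath_mul_ne _ _ h1]
    · rw [ofPath_mul_ne q r h2, mul_zero]

theorem assoc (x y z : PathAlgebra k V) : x * y * z = x * (y * z) := by
  induction x using induction_on with
  | zero => simp only [zero_mul]
  | add x x' hx hx' => simp only [add_mul, hx, hx']
  | smul c p =>
    induction y using induction_on with
    | zero => simp only [zero_mul, mul_zero]
    | add y y' hy hy' => simp only [add_mul, mul_add, hy, hy']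
    | smul d q =>
      induction z using induction_on with
      | zero => simp only [mul_zero]
      | add z z' hz hz' => simp only [mul_add, hz, hz']
      | smul e r => simp only [smul_mul, mul_smul', ofPath_assoc]

variable [Fintype V]

/-- The unit of the path algebra is the sum of the trivial paths. -/
instance : One (PathAlgebra k V) := ⟨∑ a : V, ofPath ⟨a, a, Quiver.Path.nil⟩⟩

theorem one_def : (1 : PathAlgebra k V) = ∑ a : V, ofPath ⟨a, a, Quiver.Path.nil⟩ := rfl

theorem one_mul_ofPath (p : QPath V) : (1 * ofPath p : PathAlgebra k V) = ofPath p := by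
  obtain ⟨a, b, p⟩ := p
  rw [one_def, Finset.sum_mul, Finset.sum_eq_single a, ofPath_comp, Quiver.Path.nil_comp]
  · exact fun c _ hc => ofPath_mul_ne _ _ hc.symm
  · simp

theorem ofPath_mul_one (p : QPath V) : (ofPath p * 1 : PathAlgebra k V) = ofPath p := by
  obtain ⟨a, b, p⟩ := p
  rw [one_def, Finset.mul_sum, Finset.sum_eq_single b, ofPath_comp, Quiver.Path.comp_nil]
  · exact fun c _ hc => ofPath_mul_ne _ _ hc
  · simp

instance : Ring (PathAlgebra k V) where
  mul_assoc := assoc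
  one_mul x := by
    induction x using induction_on with
    | zero => simp only [mul_zero]
    | add x y hx hy => simp only [mul_add, hx, hy]
    | smul c p => simp only [mul_smul', one_mul_ofPath]
  mul_one x := by
    induction x using induction_on with
    | zero => simp only [zero_mul]
    | add x y hx hy => simp only [add_mul, hx, hy]
    | smul c p => simp only [smul_mul, ofPath_mul_one]

instance : Algebra k (PathAlgebra k V) := Algebra.ofModule smul_mul fun c x y => mul_smul' c x y

end PathAlgebra

section Arrows

variable {V : Type v} [Quiver.{w + 1} V]

/-- A path passes through a set of arrows `A` if it is of the form `p₁ α p₂` with `α ∈ A`. -/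
def PassesThrough (A : Set (Total V)) (p : QPath V) : Prop :=
  ∃ e ∈ A, ∃ (p₁ : Quiver.Path p.1 e.left) (p₂ : Quiver.Path e.right p.2.1),
    p.2.2 = (p₁.comp e.hom.toPath).comp p₂

/-- The quiver with the same vertices whose arrows are the ones that are not in `A`. -/
abbrev removeArrows (A : Set (Total V)) : WideSubquiver V :=
  wideSubquiverEquivSetTotal.symm Aᶜ

instance [Fintype V] (A : Set (Total V)) : Fintype (removeArrows A) := inferInstanceAs (Fintype V)

/-- The inclusion of the quiver without the arrows in `A` into the whole quiver. -/
def inclusion (A : Set (Total V)) : removeArrows A ⥤q V where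
  obj a := a
  map f := f.1

/-- The set of arrows of the smaller quiver that belong to `B`. -/
def restrictArrows (A B : Set (Total V)) : Set (Total (removeArrows A)) :=
  {e | (⟨(inclusion A).obj e.left, (inclusion A).obj e.right, (inclusion A).map e.hom⟩ : Total V)
    ∈ B}

/-- A path of the smaller quiver, viewed as a path of the whole quiver. -/
def includePath (A : Set (Total V)) (p : QPath (removeArrows A)) : QPath V :=
  ⟨(inclusion A).obj p.1, (inclusion A).obj p.2.1, (inclusion A).mapPath p.2.2⟩

/-- The paths of the smaller quiver are exactly the paths that avoid `A`. -/
theorem range_includePath (A : Set (Total V)) (p : QPath V) :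
    p ∈ Set.range (includePath A) ↔ ¬ PassesThrough A p := by
  constructor
  · rintro ⟨⟨a, b, q⟩, rfl⟩ ⟨e, he, p₁, p₂, h⟩
    obtain ⟨l, r, m⟩ := e
    have key : ∀ (c : V) (p₂ : Quiver.Path r c) (q : @Quiver.Path (removeArrows A) _ a c),
        (inclusion A).mapPath q ≠ (p₁.comp m.toPath).comp p₂ := by
      intro c p₂
      induction p₂ with
      | nil =>
        intro q h
        cases q with
        | nil => cases h
        | cons q f =>
          injection h with h1 h2 h3 h4
          subst h1
          obtain rfl := eq_of_heq h4
          exact f.2 he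
      | cons p₂ g ih =>
        intro q h
        cases q with
        | nil => cases h
        | cons q f =>
          injection h with h1 h2 h3 h4
          subst h1
          exact ih q (eq_of_heq h3)
    exact key _ p₂ q h
  · intro h
    obtain ⟨a, b, p⟩ := p
    induction p with
    | nil => exact ⟨⟨a, a, Quiver.Path.nil⟩, rfl⟩
    | @cons b c p f ih =>
      obtain ⟨⟨a', b', q⟩, hq⟩ := ih (by
        rintro ⟨e, he, p₁, p₂, h'⟩
        exact h ⟨e, he, p₁, p₂.cons f, by simp only at h'; simp [h']⟩)
      simp only [includePath] at hq
      obtain ⟨rfl, hq⟩ := Sigma.mk.inj_iff.1 hq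
      obtain ⟨rfl, hq⟩ := Sigma.mk.inj_iff.1 (eq_of_heq hq)
      obtain rfl := eq_of_heq hq
      refine ⟨⟨a', c, q.cons ⟨f, fun hf => h ⟨_, hf, (inclusion A).mapPath q, Quiver.Path.nil, rfl⟩⟩⟩, rfl⟩

end Arrows

section Algebra

open PathAlgebra

variable {k : Type u} [Field k] {V : Type v} [Quiver.{w + 1} V]

open Classical in
/-- The part `z_A` of `z = z_A + z_{∤A}`: the sum of the terms of `z` whose path passes through
`A`. -/
def partThrough (A : Set (Total V)) (z : PathAlgebra k V) : PathAlgebra k V :=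
  coeffs.symm ((coeffs z).filter (PassesThrough A))

open Classical in
/-- The part `z_{∤A}` of `z = z_A + z_{∤A}`: the sum of the terms of `z` whose path avoids `A`. -/
def partAvoiding (A : Set (Total V)) (z : PathAlgebra k V) : PathAlgebra k V :=
  coeffs.symm ((coeffs z).filter fun p => ¬ PassesThrough A p)

/-- The linear map `k Q' → k Q` sending each path to itself, where `Q'` is obtained from `Q` by
removing the arrows in `A`. -/
def includeLin (A : Set (Total V)) : PathAlgebra k (removeArrows A) →ₗ[k] PathAlgebra k V :=
  lift fun p => ofPath (includePath A p)

theorem includeLin_ofPath (A : Set (Total V)) (p : QPath (removeArrows A)) :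
    includeLin A (ofPath p : PathAlgebra k (removeArrows A)) = ofPath (includePath A p) :=
  lift_ofPath _ _

theorem includeLin_mul (A : Set (Total V)) (x y : PathAlgebra k (removeArrows A)) :
    includeLin A (x * y) = includeLin A x * includeLin A y := by
  induction x using induction_on with
  | zero => simp only [zero_mul, map_zero]
  | add x x' hx hx' => simp only [add_mul, map_add, hx, hx']
  | smul c p =>
    induction y using induction_on with
    | zero => simp only [mul_zero, map_zero]
    | add y y' hy hy' => simp only [mul_add, map_add, hy, hy']
    | smul d q =>
      simp only [PathAlgebra.smul_mul, mul_smul', map_smul, includeLin_ofPath]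
      congr 2
      obtain ⟨a, b, p⟩ := p
      obtain ⟨c, d, q⟩ := q
      by_cases h : c = b
      · subst h
        rw [ofPath_comp, includeLin_ofPath, includePath, includePath, includePath, ofPath_comp,
          Prefunctor.mapPath_comp]
      · rw [ofPath_mul_ne (k := k) p q h, map_zero, includePath, includePath]
        exact (ofPath_mul_ne (k := k) ((inclusion A).mapPath p) ((inclusion A).mapPath q) h).symm

variable [Fintype V]

/-- The inclusion `k Q' → k Q` of path algebras, where `Q'` is obtained from `Q` by removing the
arrows in `A`; its image is the span of the paths of `Q` avoiding `A`. -/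
def includeAlg (A : Set (Total V)) : PathAlgebra k (removeArrows A) →ₐ[k] PathAlgebra k V :=
  AlgHom.ofLinearMap (includeLin A)
    (by
      rw [one_def, one_def, map_sum]
      exact Finset.sum_congr rfl fun a _ => includeLin_ofPath A _)
    (includeLin_mul A)

/-- An ideal `I` of `k Q` is admissible if `R ^ m ⊆ I ⊆ R ^ 2` for some `m`, where `R ^ l` is the
`l`-th power of the arrow ideal, i.e. the span of the paths of length at least `l`. -/
def IsAdmissible (I : TwoSidedIdeal (PathAlgebra k V)) : Prop :=
  (∃ m : ℕ, ∀ p : QPath V, m ≤ p.2.2.length → (ofPath p : PathAlgebra k V) ∈ I) ∧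
    ∀ z ∈ I, ∀ p : QPath V, coeffs z p ≠ 0 → 2 ≤ p.2.2.length

/-- The quotient algebra `Λ = k Q / I`. -/
abbrev BQA (I : TwoSidedIdeal (PathAlgebra k V)) : Type (max u v (w + 1)) := I.ringCon.Quotient

/-- The class in `k Q / I` of a path. -/
def pathClass (I : TwoSidedIdeal (PathAlgebra k V)) (p : QPath V) : BQA I :=
  I.ringCon.mk' (ofPath p)

/-- The ideal `⟨A + I⟩` of `k Q / I` generated by the arrows in `A`. -/
def arrowIdeal (I : TwoSidedIdeal (PathAlgebra k V)) (A : Set (Total V)) :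
    TwoSidedIdeal (BQA I) :=
  TwoSidedIdeal.span ((fun e : Total V => pathClass I ⟨e.left, e.right, e.hom.toPath⟩) '' A)

/-- A set of arrows `A` is pre-removable in `k Q / I` if `z_A` and `z_{∤A}` lie in `I` for
all `z ∈ I`. -/
def PreRemovable (I : TwoSidedIdeal (PathAlgebra k V)) (A : Set (Total V)) : Prop :=
  ∀ z ∈ I, partThrough A z ∈ I ∧ partAvoiding A z ∈ I

/-- The ideal `⟨A + I⟩` has finite projective dimension as a left `k Q / I`-module. -/
def FinitePdLeft (I : TwoSidedIdeal (PathAlgebra k V)) (A : Set (Total V)) : Prop :=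
  projectiveDimension (ModuleCat.of (BQA I) (arrowIdeal I A)) < ⊤

/-- The ideal `⟨A + I⟩` has finite projective dimension as a right `k Q / I`-module. -/
def FinitePdRight (I : TwoSidedIdeal (PathAlgebra k V)) (A : Set (Total V)) : Prop :=
  projectiveDimension (ModuleCat.of (BQA I)ᵐᵒᵖ (arrowIdeal I A)) < ⊤

/-- `A` is two-sided removable in `k Q / I`. -/
def TwoSidedRemovable (I : TwoSidedIdeal (PathAlgebra k V)) (A : Set (Total V)) : Prop :=
  PreRemovable I A ∧ FinitePdRight I A ∧ FinitePdLeft I A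

/-- `A` is non-repetitive in `k Q / I`: it is pre-removable and the square of the ideal `⟨A + I⟩`
is zero. -/
def NonRepetitive (I : TwoSidedIdeal (PathAlgebra k V)) (A : Set (Total V)) : Prop :=
  PreRemovable I A ∧ ∀ x ∈ arrowIdeal I A, ∀ y ∈ arrowIdeal I A, x * y = 0

/-- `A` is only left removable in `k Q / I`: it is non-repetitive and the ideal `⟨A + I⟩` has
finite projective dimension only as a right module. -/
def OnlyLeftRemovable (I : TwoSidedIdeal (PathAlgebra k V)) (A : Set (Total V)) : Prop :=
  NonRepetitive I A ∧ FinitePdRight I A ∧ ¬ FinitePdLeft I A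

/-- `A` is (left) removable in `k Q / I`. -/
def Removable (I : TwoSidedIdeal (PathAlgebra k V)) (A : Set (Total V)) : Prop :=
  TwoSidedRemovable I A ∨ OnlyLeftRemovable I A

/-- The ideal `I' = I ∩ span {paths avoiding A}` of `k Q'`, where `Q'` is obtained from `Q` by
removing the arrows in `A`. If `A` is pre-removable in `k Q / I`, then `k Q' / I'` is the canonical
representation of the quotient of `k Q / I` by `⟨A + I⟩`. -/
def canonicalIdeal (I : TwoSidedIdeal (PathAlgebra k V)) (A : Set (Total V)) :
    TwoSidedIdeal (PathAlgebra k (removeArrows A)) :=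
  I.comap (includeAlg A)

/-- A set of arrows `A` is eventually removable in `k Q / I` if it has an ordered partition
`A = P₀ ∪ ... ∪ P_{m-1}` such that each `P_j` is removable in the canonical representation of the
quotient of `k Q / I` by the ideal generated by the union of the `P_i`, `i < j`. Empty blocks are
allowed. -/
def EventuallyRemovable (I : TwoSidedIdeal (PathAlgebra k V)) (A : Set (Total V)) : Prop :=
  ∃ (m : ℕ) (P : Fin m → Set (Total V)), Pairwise (Function.onFun Disjoint P) ∧ ⋃ j, P j = A ∧
    ∀ j, Removable (canonicalIdeal I (⋃ i < j, P i)) (restrictArrows (⋃ i < j, P i) (P j))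

end Algebra

end BoundQuiver

end

/-! The heart is that eventually removable sets are closed under union; since there are finitely
many arrows, a unique maximal one then exists. For a set `C` of arrows let `Λ_C` be `kQ'/I'`, with
`Q'` obtained by deleting `C`. If `C ⊆ D`, inclusion of paths gives an algebra map `Λ_D → Λ_C`. If
`D` is pre-removable, killing the paths through `D` gives a map `Λ_C → Λ_D`, and the composite on
`Λ_D` is the identity. Both maps respect the ideals generated by the arrows of a fixed set `B`, so
the ideal of `B` in `Λ_D` is a semilinear retract of the one in `Λ_C`, on the left and on the right.
Finite projective dimension passes to semilinear retracts
(`projectiveDimension_lt_top_of_semilinear_retract`): the canonical free presentation is functorial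
for semilinear maps, so the syzygies are retracts again. Vanishing of the square of the ideal passes
along the injective map `Λ_D → Λ_C`. Pre-removability is stable under union because discarding the
paths through `A ∪ B` amounts to discarding those through `B` and then those through `A`. Thus
removability survives the passage from `C` to `D` (`Removable.mono`), and the blocks of one
eventually removable set can be appended one by one to another. -/

section Retract

/-! ### Projective dimension of semilinear retracts -/

variable {R S : Type u} [Ring R] [Ring S]

/-- The additive map between free modules induced by a ring homomorphism and a map of bases. -/
noncomputable def freeMap (φ : R →+* S) {X Y : Type*} (f : X → Y) : (X →₀ R) →ₛₗ[φ] (Y →₀ S) where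
  toFun a := Finsupp.mapDomain f (Finsupp.mapRange φ (map_zero φ) a)
  map_add' a b := by
    rw [Finsupp.mapRange_add (map_add φ), Finsupp.mapDomain_add]
  map_smul' r a := by
    rw [← Finsupp.mapDomain_smul]
    congr 1
    ext x
    simp

theorem freeMap_single (φ : R →+* S) {X Y : Type*} (f : X → Y) (x : X) (r : R) :
    freeMap φ f (Finsupp.single x r) = Finsupp.single (f x) (φ r) := by
  simp [freeMap]

/-- Naturality of the canonical free presentation; this is what lets semilinear maps act on
syzygies. -/
theorem linearCombination_freeMap (φ : R →+* S) {X Y : Type*} [AddCommGroup X] [Module R X]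
    [AddCommGroup Y] [Module S Y] (f : X →ₛₗ[φ] Y) (a : X →₀ R) :
    Finsupp.linearCombination S id (freeMap φ f a) = f (Finsupp.linearCombination R id a) := by
  induction a using Finsupp.induction_linear with
  | zero => simp
  | add a b ha hb => simp only [map_add, ha, hb]
  | single x r => simp [freeMap_single]

theorem freeMap_freeMap {i : S →+* R} {π : R →+* S} (h : ∀ s, π (i s) = s) {X Y : Type*}
    {f : X → Y} {g : Y → X} (hgf : ∀ x, g (f x) = x) (a : X →₀ S) :
    freeMap π g (freeMap i f a) = a := by
  induction a using Finsupp.induction_linear with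
  | zero => simp
  | add a b ha hb => simp only [map_add, ha, hb]
  | single x r => simp [freeMap_single, h, hgf]

/-- The kernel of the canonical free presentation of a module. -/
noncomputable abbrev freeSyzygy (R : Type u) [Ring R] (X : Type u) [AddCommGroup X] [Module R X] :
    Submodule R (X →₀ R) :=
  LinearMap.ker (Finsupp.linearCombination R (id : X → X))

/-- The map between the kernels of the canonical free presentations induced by a semilinear map. -/
noncomputable def freeSyzygyMap {φ : R →+* S} {X Y : Type u} [AddCommGroup X] [Module R X]
    [AddCommGroup Y] [Module S Y] (f : X →ₛₗ[φ] Y) : freeSyzygy R X →ₛₗ[φ] freeSyzygy S Y where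
  toFun a := ⟨freeMap φ f a.1, by
    rw [LinearMap.mem_ker, linearCombination_freeMap, LinearMap.mem_ker.1 a.2, map_zero]⟩
  map_add' a b := Subtype.ext (map_add (freeMap φ f) a.1 b.1)
  map_smul' r a := Subtype.ext (map_smulₛₗ (freeMap φ f) r a.1)

/-- The canonical free presentation of a module as a short complex. -/
noncomputable abbrev freePresentation (R : Type u) [Ring R] (X : Type u) [AddCommGroup X]
    [Module R X] : ShortComplex (ModuleCat.{u} R) :=
  ShortComplex.mk (X₁ := ModuleCat.of R (freeSyzygy R X)) (X₂ := ModuleCat.of R (X →₀ R))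
    (X₃ := ModuleCat.of R X) (ModuleCat.ofHom (freeSyzygy R X).subtype)
    (ModuleCat.ofHom (Finsupp.linearCombination R (id : X → X)))
    (ModuleCat.hom_ext (LinearMap.ext fun a => LinearMap.mem_ker.1 a.2))

theorem freePresentation_shortExact (R : Type u) [Ring R] (X : Type u) [AddCommGroup X]
    [Module R X] : (freePresentation R X).ShortExact where
  exact := by
    rw [ShortComplex.moduleCat_exact_iff]
    intro a ha
    exact ⟨⟨a, ha⟩, rfl⟩
  mono_f := by
    rw [ModuleCat.mono_iff_injective]
    exact Subtype.val_injective
  epi_g := by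
    rw [ModuleCat.epi_iff_surjective]
    exact Finsupp.linearCombination_id_surjective R X

/-- Dimension shift along a free middle term. It starts at `n + 2` because dimension `< 1` means
projective and `< 0` means zero, and the canonical syzygy of a projective module need not vanish. -/
theorem hasProjectiveDimensionLT_freeSyzygy_iff (X : Type u) [AddCommGroup X] [Module R X]
    (n : ℕ) : HasProjectiveDimensionLT (ModuleCat.of R X) (n + 2) ↔
      HasProjectiveDimensionLT (ModuleCat.of R (freeSyzygy R X)) (n + 1) :=
  (freePresentation_shortExact R X).hasProjectiveDimensionLT_X₃_iff n
    ((IsProjective.iff_projective (R := R) (X →₀ R)).1 inferInstance)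

/-- A section `s` of the free presentation of `Y` transports to the section `freeMap π g ∘ s ∘ f`
for `X`. It is `S`-linear because `π ∘ i` is the identity. -/
theorem projective_of_semilinear_retract {i : S →+* R} {π : R →+* S} (h : ∀ s, π (i s) = s)
    {X Y : Type u} [AddCommGroup X] [Module S X] [AddCommGroup Y] [Module R Y]
    (f : X →ₛₗ[i] Y) (g : Y →ₛₗ[π] X) (hgf : ∀ x, g (f x) = x) [hY : Module.Projective R Y] :
    Module.Projective S X := by
  obtain ⟨s, hs⟩ := hY.out
  refine ⟨⟨{ toFun := fun x => freeMap π g (s (f x)), map_add' := ?_, map_smul' := ?_ }, ?_⟩⟩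
  · intro x y
    simp only [map_add]
  · intro r x
    simp only [map_smulₛₗ, RingHom.id_apply, h]
  · intro x
    change Finsupp.linearCombination S id (freeMap π g (s (f x))) = x
    rw [linearCombination_freeMap, hs, hgf]

/-- Induction by dimension shift: `freeSyzygyMap` turns the retraction of modules into one of
syzygies. The zero and projective cases are separate since the shift does not reach them. -/
theorem hasProjectiveDimensionLT_of_semilinear_retract {i : S →+* R} {π : R →+* S}
    (h : ∀ s, π (i s) = s) (n : ℕ) {X Y : Type u} [AddCommGroup X] [Module S X] [AddCommGroup Y]
    [Module R Y] (f : X →ₛₗ[i] Y) (g : Y →ₛₗ[π] X) (hgf : ∀ x, g (f x) = x)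
    (hY : HasProjectiveDimensionLT (ModuleCat.of R Y) n) :
    HasProjectiveDimensionLT (ModuleCat.of S X) n := by
  induction n using Nat.twoStepInduction generalizing X Y with
  | zero =>
    rw [hasProjectiveDimensionLT_zero_iff_isZero, ModuleCat.isZero_of_iff_subsingleton] at hY ⊢
    exact (Function.LeftInverse.injective hgf).subsingleton
  | one =>
    rw [← projective_iff_hasProjectiveDimensionLT_one, ← IsProjective.iff_projective] at hY ⊢
    exact projective_of_semilinear_retract h f g hgf
  | more n _ ih =>
    rw [hasProjectiveDimensionLT_freeSyzygy_iff] at hY ⊢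
    exact ih (freeSyzygyMap f) (freeSyzygyMap g)
      (fun a => Subtype.ext (freeMap_freeMap h hgf a.1)) hY

theorem projectiveDimension_lt_top_of_semilinear_retract {i : S →+* R} {π : R →+* S}
    (h : ∀ s, π (i s) = s) {X Y : Type u} [AddCommGroup X] [Module S X] [AddCommGroup Y]
    [Module R Y] (f : X →ₛₗ[i] Y) (g : Y →ₛₗ[π] X) (hgf : ∀ x, g (f x) = x)
    (hY : projectiveDimension (ModuleCat.of R Y) < ⊤) :
    projectiveDimension (ModuleCat.of S X) < ⊤ := by
  rw [lt_top_iff_ne_top, projectiveDimension_ne_top_iff] at hY ⊢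
  obtain ⟨n, hn⟩ := hY
  exact ⟨n, hasProjectiveDimensionLT_of_semilinear_retract h _ f g hgf hn⟩

end Retract

noncomputable section

namespace BoundQuiver

/-! ### Paths through a set of arrows and paths of the smaller quiver -/

section Paths

variable {V : Type v} [Quiver.{w + 1} V]

theorem not_passesThrough_nil (A : Set (Total V)) (a : V) :
    ¬ PassesThrough A ⟨a, a, Quiver.Path.nil⟩ := by
  rintro ⟨e, -, p₁, p₂, h⟩
  have := congrArg Quiver.Path.length h
  simp at this
  omega

theorem passesThrough_cons (A : Set (Total V)) {a b c : V} (p : Quiver.Path a b) (f : b ⟶ c) :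
    PassesThrough A ⟨a, c, p.cons f⟩ ↔ PassesThrough A ⟨a, b, p⟩ ∨ (⟨b, c, f⟩ : Total V) ∈ A := by
  constructor
  · rintro ⟨⟨l, r, m⟩, he, p₁, p₂, h⟩
    cases p₂ with
    | nil =>
      injection h with h1 h2 h3 h4
      subst h1
      obtain rfl := eq_of_heq h4
      exact Or.inr he
    | cons p₂ g =>
      injection h with h1 h2 h3 h4
      subst h1
      exact Or.inl ⟨_, he, p₁, p₂, eq_of_heq h3⟩
  · rintro (⟨e, he, p₁, p₂, h⟩ | h)
    · exact ⟨e, he, p₁, p₂.cons f, by simp only at h; simp [h]⟩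
    · exact ⟨_, h, p, Quiver.Path.nil, rfl⟩

theorem passesThrough_toPath (A : Set (Total V)) (e : Total V) :
    PassesThrough A ⟨e.left, e.right, e.hom.toPath⟩ ↔ e ∈ A := by
  refine (passesThrough_cons A Quiver.Path.nil e.hom).trans ?_
  exact or_iff_right (not_passesThrough_nil A e.left)

theorem passesThrough_comp (A : Set (Total V)) {a b c : V} (p : Quiver.Path a b)
    (q : Quiver.Path b c) :
    PassesThrough A ⟨a, c, p.comp q⟩ ↔ PassesThrough A ⟨a, b, p⟩ ∨ PassesThrough A ⟨b, c, q⟩ := by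
  induction q with
  | nil => simp [not_passesThrough_nil]
  | cons q f ih => rw [Quiver.Path.comp_cons, passesThrough_cons, passesThrough_cons, ih, or_assoc]

theorem passesThrough_union (A B : Set (Total V)) (p : QPath V) :
    PassesThrough (A ∪ B) p ↔ PassesThrough A p ∨ PassesThrough B p := by
  simp only [PassesThrough, Set.mem_union, or_and_right, exists_or]

/-- An included path never meets `A`, so `A ∪ B` tests the same as `B`; the union is the form that
matches removal in two stages. -/
theorem passesThrough_restrictArrows (A B : Set (Total V)) (p : QPath (removeArrows A)) :
    PassesThrough (restrictArrows A B) p ↔ PassesThrough (A ∪ B) (includePath A p) := by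
  obtain ⟨a, b, p⟩ := p
  induction p with
  | nil => exact iff_of_false (not_passesThrough_nil _ _) (not_passesThrough_nil _ _)
  | @cons b c p f ih =>
    refine (passesThrough_cons _ p f).trans (Iff.trans ?_ (passesThrough_cons _ _ _).symm)
    refine or_congr ih ⟨fun h => Or.inr h, fun h => h.resolve_left f.2⟩

theorem restrictArrows_diff_self (A B : Set (Total V)) :
    restrictArrows A (B \ A) = restrictArrows A B := by
  ext e
  exact ⟨fun h => h.1, fun h => ⟨h, e.hom.2⟩⟩

theorem mapPath_inclusion_injective (A : Set (Total V)) {a b : removeArrows A}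
    (p q : Quiver.Path a b) (h : (inclusion A).mapPath p = (inclusion A).mapPath q) : p = q := by
  induction p with
  | nil =>
    cases q with
    | nil => rfl
    | cons q g => cases h
  | cons p f ih =>
    cases q with
    | nil => cases h
    | cons q g =>
      injection h with h1 h2 h3 h4
      subst h1
      obtain rfl := ih q (eq_of_heq h3)
      obtain rfl : f = g := Subtype.ext (eq_of_heq h4)
      rfl

theorem includePath_injective (A : Set (Total V)) : Function.Injective (includePath A) := by
  rintro ⟨a, b, p⟩ ⟨c, d, q⟩ h
  obtain ⟨h1, h⟩ := Sigma.mk.inj_iff.1 h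
  obtain rfl : a = c := h1
  obtain ⟨h2, h⟩ := Sigma.mk.inj_iff.1 (eq_of_heq h)
  obtain rfl : b = d := h2
  rw [mapPath_inclusion_injective A p q (eq_of_heq h)]

theorem length_includePath (A : Set (Total V)) (p : QPath (removeArrows A)) :
    (includePath A p).2.2.length = p.2.2.length := by
  obtain ⟨a, b, p⟩ := p
  induction p with
  | nil => rfl
  | cons p f ih => exact congrArg (· + 1) ih

end Paths

/-! ### Inclusion and retraction between the path algebras -/

section Parts

open PathAlgebra

variable {k : Type u} [Field k] {V : Type v} [Quiver.{w + 1} V]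

theorem linearMap_ext {M : Type*} [AddCommMonoid M] [Module k M] {f g : PathAlgebra k V →ₗ[k] M}
    (h : ∀ p, f (ofPath p) = g (ofPath p)) : f = g := by
  ext x
  induction x using PathAlgebra.induction_on with
  | zero => simp only [map_zero]
  | add x y hx hy => simp only [map_add, hx, hy]
  | smul c p => simp only [map_smul, h]

theorem coeffs_ofPath (p : QPath V) :
    coeffs (ofPath p : PathAlgebra k V) = Finsupp.single p 1 := rfl

theorem partThrough_add_partAvoiding (A : Set (Total V)) (z : PathAlgebra k V) :
    partThrough A z + partAvoiding A z = z := by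
  classical
  rw [partThrough, partAvoiding, ← map_add, Finsupp.filter_add_filter_not,
    LinearEquiv.symm_apply_apply]

open Classical in
/-- The part of an element of the path algebra that avoids a set of arrows, as a linear map. -/
def avoidingLin (A : Set (Total V)) : PathAlgebra k V →ₗ[k] PathAlgebra k V :=
  lift fun p => if PassesThrough A p then 0 else ofPath p

theorem avoidingLin_ofPath_of_passesThrough {A : Set (Total V)} {p : QPath V}
    (h : PassesThrough A p) : avoidingLin A (ofPath p : PathAlgebra k V) = 0 := by
  rw [avoidingLin, lift_ofPath, if_pos h]

theorem avoidingLin_ofPath_of_not_passesThrough {A : Set (Total V)} {p : QPath V}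
    (h : ¬ PassesThrough A p) : avoidingLin A (ofPath p : PathAlgebra k V) = ofPath p := by
  rw [avoidingLin, lift_ofPath, if_neg h]

theorem partAvoiding_eq_avoidingLin (A : Set (Total V)) (z : PathAlgebra k V) :
    partAvoiding A z = avoidingLin A z := by
  classical
  induction z using PathAlgebra.induction_on with
  | zero => rw [partAvoiding, map_zero, Finsupp.filter_zero, map_zero, map_zero]
  | add x y hx hy => rw [map_add, ← hx, ← hy, partAvoiding, map_add, Finsupp.filter_add, map_add]; rfl
  | smul c p =>
    rw [map_smul, partAvoiding, map_smul, Finsupp.filter_smul, map_smul, ofPath,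
      LinearEquiv.apply_symm_apply]
    congr 1
    by_cases h : PassesThrough A p
    · rw [Finsupp.filter_single_of_neg (fun p => ¬ PassesThrough A p) (not_not.2 h), map_zero]
      exact (avoidingLin_ofPath_of_passesThrough h).symm
    · rw [Finsupp.filter_single_of_pos (fun p => ¬ PassesThrough A p) h]
      exact (avoidingLin_ofPath_of_not_passesThrough h).symm

theorem avoidingLin_union (A B : Set (Total V)) (z : PathAlgebra k V) :
    avoidingLin (A ∪ B) z = avoidingLin A (avoidingLin B z) := by
  suffices h : avoidingLin (k := k) (A ∪ B) = avoidingLin A ∘ₗ avoidingLin B from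
    LinearMap.congr_fun h z
  refine linearMap_ext fun p => ?_
  rw [LinearMap.comp_apply]
  by_cases hB : PassesThrough B p
  · rw [avoidingLin_ofPath_of_passesThrough ((passesThrough_union A B p).2 (Or.inr hB)),
      avoidingLin_ofPath_of_passesThrough hB, map_zero]
  · rw [avoidingLin_ofPath_of_not_passesThrough hB]
    by_cases hA : PassesThrough A p
    · rw [avoidingLin_ofPath_of_passesThrough ((passesThrough_union A B p).2 (Or.inl hA)),
        avoidingLin_ofPath_of_passesThrough hA]
    · rw [avoidingLin_ofPath_of_not_passesThrough hA, avoidingLin_ofPath_of_not_passesThrough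
        fun h => ((passesThrough_union A B p).1 h).elim hA hB]

/-- A concatenation avoids `A` exactly when both factors do. This is why the retraction onto the
smaller path algebra is multiplicative. -/
theorem avoidingLin_mul (A : Set (Total V)) (x y : PathAlgebra k V) :
    avoidingLin A (x * y) = avoidingLin A x * avoidingLin A y := by
  induction x using PathAlgebra.induction_on with
  | zero => simp only [zero_mul, map_zero]
  | add x x' hx hx' => simp only [add_mul, map_add, hx, hx']
  | smul c p =>
    induction y using PathAlgebra.induction_on with
    | zero => simp only [mul_zero, map_zero]
    | add y y' hy hy' => simp only [mul_add, map_add, hy, hy']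
    | smul d q =>
      simp only [PathAlgebra.smul_mul, mul_smul', map_smul]
      congr 2
      obtain ⟨a, b, p⟩ := p
      obtain ⟨c, d, q⟩ := q
      by_cases h : c = b
      · subst h
        rw [ofPath_comp]
        by_cases hp : PassesThrough A ⟨a, c, p⟩
        · rw [avoidingLin_ofPath_of_passesThrough hp, zero_mul,
            avoidingLin_ofPath_of_passesThrough ((passesThrough_comp A p q).2 (Or.inl hp))]
        · by_cases hq : PassesThrough A ⟨c, d, q⟩
          · rw [avoidingLin_ofPath_of_passesThrough hq, mul_zero,
              avoidingLin_ofPath_of_passesThrough ((passesThrough_comp A p q).2 (Or.inr hq))]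
          · rw [avoidingLin_ofPath_of_not_passesThrough hp,
              avoidingLin_ofPath_of_not_passesThrough hq, ofPath_comp,
              avoidingLin_ofPath_of_not_passesThrough
                fun h => ((passesThrough_comp A p q).1 h).elim hp hq]
      · rw [ofPath_mul_ne p q h, map_zero]
        by_cases hp : PassesThrough A ⟨a, b, p⟩
        · rw [avoidingLin_ofPath_of_passesThrough hp, zero_mul]
        · by_cases hq : PassesThrough A ⟨c, d, q⟩
          · rw [avoidingLin_ofPath_of_passesThrough hq, mul_zero]
          · rw [avoidingLin_ofPath_of_not_passesThrough hp,
              avoidingLin_ofPath_of_not_passesThrough hq, ofPath_mul_ne p q h]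

open Classical in
/-- The linear map `k Q → k Q'` that sends the paths through `A` to zero and every other path to
itself, where `Q'` is obtained from `Q` by removing the arrows in `A`. -/
def retractLin (A : Set (Total V)) : PathAlgebra k V →ₗ[k] PathAlgebra k (removeArrows A) :=
  lift fun p => if h : p ∈ Set.range (includePath A) then ofPath h.choose else 0

theorem retractLin_ofPath_includePath (A : Set (Total V)) (p : QPath (removeArrows A)) :
    retractLin A (ofPath (includePath A p) : PathAlgebra k V) = ofPath p := by
  have h : includePath A p ∈ Set.range (includePath A) := ⟨p, rfl⟩
  rw [retractLin, lift_ofPath, dif_pos h, includePath_injective A h.choose_spec]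

theorem retractLin_ofPath_of_passesThrough {A : Set (Total V)} {p : QPath V}
    (h : PassesThrough A p) : retractLin A (ofPath p : PathAlgebra k V) = 0 := by
  rw [retractLin, lift_ofPath, dif_neg fun h' => (range_includePath A p).1 h' h]

theorem retractLin_includeLin (A : Set (Total V)) (z : PathAlgebra k (removeArrows A)) :
    retractLin A (includeLin A z) = z := by
  suffices h : retractLin (k := k) A ∘ₗ includeLin A = LinearMap.id from LinearMap.congr_fun h z
  refine linearMap_ext fun p => ?_
  rw [LinearMap.comp_apply, includeLin_ofPath, retractLin_ofPath_includePath, LinearMap.id_apply]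

theorem includeLin_retractLin (A : Set (Total V)) (z : PathAlgebra k V) :
    includeLin A (retractLin A z) = avoidingLin A z := by
  suffices h : includeLin A ∘ₗ retractLin A = avoidingLin (k := k) A from LinearMap.congr_fun h z
  refine linearMap_ext fun p => ?_
  rw [LinearMap.comp_apply]
  by_cases h : PassesThrough A p
  · rw [retractLin_ofPath_of_passesThrough h, map_zero, avoidingLin_ofPath_of_passesThrough h]
  · obtain ⟨q, rfl⟩ := (range_includePath A p).2 h
    rw [retractLin_ofPath_includePath, includeLin_ofPath,
      avoidingLin_ofPath_of_not_passesThrough h]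

theorem includeLin_injective (A : Set (Total V)) :
    Function.Injective (includeLin (k := k) A) :=
  Function.LeftInverse.injective (retractLin_includeLin A)

theorem avoidingLin_includeLin {A B : Set (Total V)} (h : A ⊆ B)
    (z : PathAlgebra k (removeArrows B)) : avoidingLin A (includeLin B z) = includeLin B z := by
  rw [← retractLin_includeLin B z, includeLin_retractLin, ← avoidingLin_union,
    Set.union_eq_self_of_subset_left h]

theorem includeLin_avoidingLin_restrictArrows (A B : Set (Total V))
    (z : PathAlgebra k (removeArrows A)) :
    includeLin A (avoidingLin (restrictArrows A B) z) = avoidingLin (A ∪ B) (includeLin A z) := by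
  suffices h : includeLin A ∘ₗ avoidingLin (restrictArrows A B) =
      avoidingLin (k := k) (A ∪ B) ∘ₗ includeLin A from LinearMap.congr_fun h z
  refine linearMap_ext fun p => ?_
  rw [LinearMap.comp_apply, LinearMap.comp_apply, includeLin_ofPath]
  by_cases h : PassesThrough (restrictArrows A B) p
  · rw [avoidingLin_ofPath_of_passesThrough h, map_zero, avoidingLin_ofPath_of_passesThrough
      ((passesThrough_restrictArrows A B p).1 h)]
  · rw [avoidingLin_ofPath_of_not_passesThrough h, includeLin_ofPath,
      avoidingLin_ofPath_of_not_passesThrough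
        fun h' => h ((passesThrough_restrictArrows A B p).2 h')]

theorem coeffs_includeLin (A : Set (Total V)) (z : PathAlgebra k (removeArrows A))
    (p : QPath (removeArrows A)) : coeffs (includeLin A z) (includePath A p) = coeffs z p := by
  suffices h : Finsupp.lapply (includePath A p) ∘ₗ coeffs.toLinearMap ∘ₗ includeLin A =
      Finsupp.lapply (R := k) p ∘ₗ coeffs.toLinearMap from LinearMap.congr_fun h z
  refine linearMap_ext fun q => ?_
  classical
  simp [includeLin_ofPath, coeffs_ofPath, Finsupp.single_apply, (includePath_injective A).eq_iff]

variable [Fintype V]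

/-- The algebra homomorphism `k Q → k Q'` that sends the paths through `A` to zero and every other
path to itself, where `Q'` is obtained from `Q` by removing the arrows in `A`. -/
def retractAlg (A : Set (Total V)) : PathAlgebra k V →ₐ[k] PathAlgebra k (removeArrows A) :=
  AlgHom.ofLinearMap (retractLin A)
    (by
      rw [← map_one (includeAlg A)]
      exact retractLin_includeLin A 1)
    -- Multiplicativity is tested after the injective inclusion, where the retraction becomes
    -- `avoidingLin A`.
    (fun x y => includeLin_injective A <| by
      rw [includeLin_mul, includeLin_retractLin, includeLin_retractLin, includeLin_retractLin,
        avoidingLin_mul])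

theorem retractAlg_includeAlg (A : Set (Total V)) (z : PathAlgebra k (removeArrows A)) :
    retractAlg A (includeAlg A z) = z :=
  retractLin_includeLin A z

theorem includeAlg_retractAlg (A : Set (Total V)) (z : PathAlgebra k V) :
    includeAlg A (retractAlg A z) = avoidingLin A z :=
  includeLin_retractLin A z

end Parts

end BoundQuiver

end

noncomputable section

/-! ### Semilinear maps of two-sided ideals and maps of quotients -/

section TwoSidedIdealMaps

variable {R S : Type*} [Ring R] [Ring S]

/-- A ring homomorphism that maps a two-sided ideal into another one, as a semilinear map of left
modules. -/
def TwoSidedIdeal.leftSemilinearMap (f : R →+* S) {I : TwoSidedIdeal R} {J : TwoSidedIdeal S}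
    (h : ∀ x ∈ I, f x ∈ J) : I →ₛₗ[f] J where
  toFun x := ⟨f x.1, h x.1 x.2⟩
  map_add' x y := Subtype.ext (map_add f x.1 y.1)
  map_smul' r x := Subtype.ext (map_mul f r x.1)

/-- A ring homomorphism that maps a two-sided ideal into another one, as a semilinear map of right
modules. -/
def TwoSidedIdeal.rightSemilinearMap (f : R →+* S) {I : TwoSidedIdeal R} {J : TwoSidedIdeal S}
    (h : ∀ x ∈ I, f x ∈ J) : I →ₛₗ[RingHom.op f] J where
  toFun x := ⟨f x.1, h x.1 x.2⟩
  map_add' x y := Subtype.ext (map_add f x.1 y.1)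
  map_smul' r x := Subtype.ext (map_mul f x.1 r.unop)

variable {k : Type*} [CommSemiring k] [Algebra k R] [Algebra k S]

/-- The homomorphism between quotient algebras induced by an algebra homomorphism. -/
def TwoSidedIdeal.quotientMapₐ (I : TwoSidedIdeal R) (J : TwoSidedIdeal S) (f : R →ₐ[k] S)
    (h : ∀ x ∈ I, f x ∈ J) : I.ringCon.Quotient →ₐ[k] J.ringCon.Quotient :=
  I.ringCon.liftₐ ((J.ringCon.mkₐ k).comp f) fun x y hxy => by
    refine (RingCon.eq _).2 ((J.rel_iff _ _).2 ?_)
    have := h _ ((I.rel_iff _ _).1 hxy)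
    rwa [map_sub] at this

theorem TwoSidedIdeal.quotientMapₐ_mk' (I : TwoSidedIdeal R) (J : TwoSidedIdeal S)
    (f : R →ₐ[k] S) (h : ∀ x ∈ I, f x ∈ J) (x : R) :
    TwoSidedIdeal.quotientMapₐ I J f h (I.ringCon.mk' x) = J.ringCon.mk' (f x) := rfl

theorem TwoSidedIdeal.mk'_eq_zero_iff (I : TwoSidedIdeal R) (x : R) :
    I.ringCon.mk' x = 0 ↔ x ∈ I := by
  rw [← TwoSidedIdeal.mem_ker, TwoSidedIdeal.ker_ringCon_mk']

end TwoSidedIdealMaps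

namespace BoundQuiver

open PathAlgebra

/-! ### Pre-removable sets -/

variable {k : Type u} [Field k] {V : Type v} [Quiver.{w + 1} V] [Fintype V]

theorem mem_canonicalIdeal {I : TwoSidedIdeal (PathAlgebra k V)} {A : Set (Total V)}
    {z : PathAlgebra k (removeArrows A)} : z ∈ canonicalIdeal I A ↔ includeAlg A z ∈ I :=
  TwoSidedIdeal.mem_comap _

/-- As `z_A = z - z_{∤A}`, one of the two conditions suffices. -/
theorem preRemovable_iff {I : TwoSidedIdeal (PathAlgebra k V)} {A : Set (Total V)} :
    PreRemovable I A ↔ ∀ z ∈ I, avoidingLin A z ∈ I := by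
  refine forall₂_congr fun z hz => ⟨fun h => ?_, fun h => ?_⟩
  · rw [← partAvoiding_eq_avoidingLin]
    exact h.2
  · rw [← partAvoiding_eq_avoidingLin] at h
    refine ⟨?_, h⟩
    rw [eq_sub_of_add_eq (partThrough_add_partAvoiding A z)]
    exact I.sub_mem hz h

theorem preRemovable_empty (I : TwoSidedIdeal (PathAlgebra k V)) :
    PreRemovable I (∅ : Set (Total V)) := by
  refine preRemovable_iff.2 fun z hz => ?_
  have h : avoidingLin (k := k) (∅ : Set (Total V)) = LinearMap.id := by
    refine linearMap_ext fun p => avoidingLin_ofPath_of_not_passesThrough ?_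
    rintro ⟨e, he, -⟩
    exact he
  rwa [h]

theorem PreRemovable.union {I : TwoSidedIdeal (PathAlgebra k V)} {A B : Set (Total V)}
    (hA : PreRemovable I A) (hB : PreRemovable I B) : PreRemovable I (A ∪ B) := by
  rw [preRemovable_iff] at *
  intro z hz
  rw [avoidingLin_union]
  exact hA _ (hB z hz)

theorem PreRemovable.restrictArrows {I : TwoSidedIdeal (PathAlgebra k V)} {A B : Set (Total V)}
    (h : PreRemovable I (A ∪ B)) : PreRemovable (canonicalIdeal I A) (restrictArrows A B) := by
  rw [preRemovable_iff] at *
  intro z hz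
  rw [mem_canonicalIdeal] at *
  have := h _ hz
  rwa [includeAlg, AlgHom.ofLinearMap_apply, ← includeLin_avoidingLin_restrictArrows] at this

/-- Discard the paths through `A`, regard the rest as an element of the smaller ideal, and there
discard the paths through `B`. -/
theorem PreRemovable.union_of_restrictArrows {I : TwoSidedIdeal (PathAlgebra k V)}
    {A B : Set (Total V)} (hA : PreRemovable I A)
    (hB : PreRemovable (canonicalIdeal I A) (BoundQuiver.restrictArrows A B)) :
    PreRemovable I (A ∪ B) := by
  rw [preRemovable_iff] at *
  intro z hz
  have h : retractAlg A z ∈ canonicalIdeal I A := by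
    rw [mem_canonicalIdeal, includeAlg_retractAlg]
    exact hA z hz
  have h' := hB _ h
  rw [mem_canonicalIdeal, includeAlg, AlgHom.ofLinearMap_apply,
    includeLin_avoidingLin_restrictArrows] at h'
  change avoidingLin (A ∪ B) (includeLin A (retractLin A z)) ∈ I at h'
  rwa [includeLin_retractLin, ← avoidingLin_union, Set.union_right_comm, Set.union_self] at h'

theorem arrowIdeal_le_comap {V' : Type v} [Quiver.{w + 1} V'] [Fintype V']
    {I : TwoSidedIdeal (PathAlgebra k V)} {I' : TwoSidedIdeal (PathAlgebra k V')}
    {A : Set (Total V)} {J : TwoSidedIdeal (BQA I')} (f : BQA I →+* BQA I')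
    (h : ∀ e ∈ A, f (pathClass I ⟨e.left, e.right, e.hom.toPath⟩) ∈ J) :
    ∀ x ∈ arrowIdeal I A, f x ∈ J := by
  have : arrowIdeal I A ≤ J.comap f := by
    refine TwoSidedIdeal.span_le.2 ?_
    rintro _ ⟨e, he, rfl⟩
    exact (TwoSidedIdeal.mem_comap f).2 (h e he)
  exact fun x hx => (TwoSidedIdeal.mem_comap f).1 (this hx)

/-- An arrow of the smaller quiver, viewed as an arrow of the whole quiver. -/
def includeArrow (A : Set (Total V)) (e : Total (removeArrows A)) : Total V :=
  ⟨(inclusion A).obj e.left, (inclusion A).obj e.right, (inclusion A).map e.hom⟩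

/-- An arrow that is not removed, viewed as an arrow of the smaller quiver. -/
def keepArrow (A : Set (Total V)) (e : Total V) (he : e ∉ A) : Total (removeArrows A) :=
  ⟨e.left, e.right, ⟨e.hom, he⟩⟩

/-- An arrow as a path of length one. -/
def arrowPath {W : Type v} [Quiver.{w + 1} W] (e : Total W) : QPath W :=
  ⟨e.left, e.right, e.hom.toPath⟩

theorem retractAlg_includeAlg_arrow {C D : Set (Total V)} (e : Total (removeArrows C))
    (he : includeArrow C e ∉ D) :
    retractAlg D (includeAlg C (ofPath (arrowPath e) : PathAlgebra k (removeArrows C))) =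
      ofPath (arrowPath (keepArrow D (includeArrow C e) he)) := by
  have h : includePath C (arrowPath e) =
      includePath D (arrowPath (keepArrow D (includeArrow C e) he)) := rfl
  change retractLin D (includeLin C (ofPath (arrowPath e))) = _
  rw [includeLin_ofPath, h, retractLin_ofPath_includePath]

theorem retractAlg_includeAlg_arrow_of_mem {C D : Set (Total V)} (e : Total (removeArrows C))
    (he : includeArrow C e ∈ D) :
    retractAlg D (includeAlg C (ofPath (arrowPath e) : PathAlgebra k (removeArrows C))) = 0 := by
  refine (congrArg (retractLin D) (includeLin_ofPath C _)).trans ?_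
  exact retractLin_ofPath_of_passesThrough ((passesThrough_toPath D (includeArrow C e)).2 he)

/-! ### Comparison of canonical representations for `C ⊆ D` -/

section Comparison

variable (I : TwoSidedIdeal (PathAlgebra k V)) {C D : Set (Total V)}

/-- If `C ⊆ D`, then the quotient of `k Q / I` by the arrows in `D` embeds into the quotient by the
arrows in `C`. -/
def canonicalInclusion (h : C ⊆ D) :
    BQA (canonicalIdeal I D) →ₐ[k] BQA (canonicalIdeal I C) :=
  TwoSidedIdeal.quotientMapₐ _ _ ((retractAlg C).comp (includeAlg D)) fun x hx => by
    rw [mem_canonicalIdeal, AlgHom.comp_apply, includeAlg_retractAlg, includeAlg,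
      AlgHom.ofLinearMap_apply, avoidingLin_includeLin h]
    exact mem_canonicalIdeal.1 hx

/-- If `D` is pre-removable, then the quotient of `k Q / I` by the arrows in `C` maps to the
quotient by the arrows in `D` by sending the arrows in `D` to zero. -/
def canonicalProjection (C : Set (Total V)) (hD : PreRemovable I D) :
    BQA (canonicalIdeal I C) →ₐ[k] BQA (canonicalIdeal I D) :=
  TwoSidedIdeal.quotientMapₐ _ _ ((retractAlg D).comp (includeAlg C)) fun x hx => by
    rw [mem_canonicalIdeal, AlgHom.comp_apply, includeAlg_retractAlg]
    exact preRemovable_iff.1 hD _ (mem_canonicalIdeal.1 hx)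

theorem canonicalProjection_canonicalInclusion (h : C ⊆ D) (hD : PreRemovable I D)
    (x : BQA (canonicalIdeal I D)) :
    canonicalProjection I C hD (canonicalInclusion I h x) = x := by
  obtain ⟨x, rfl⟩ := RingCon.mk'_surjective _ x
  rw [canonicalInclusion, TwoSidedIdeal.quotientMapₐ_mk', canonicalProjection,
    TwoSidedIdeal.quotientMapₐ_mk', AlgHom.comp_apply, AlgHom.comp_apply, includeAlg_retractAlg]
  congr 1
  rw [includeAlg, AlgHom.ofLinearMap_apply, avoidingLin_includeLin h]
  exact retractLin_includeLin D x

theorem canonicalInclusion_mem_arrowIdeal (h : C ⊆ D) (B : Set (Total V)) :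
    ∀ x ∈ arrowIdeal (canonicalIdeal I D) (restrictArrows D B),
      canonicalInclusion I h x ∈ arrowIdeal (canonicalIdeal I C) (restrictArrows C B) := by
  refine arrowIdeal_le_comap (canonicalInclusion I h).toRingHom fun e he => ?_
  have hC : includeArrow D e ∉ C := fun h' => e.hom.2 (h h')
  have key : canonicalInclusion I h (pathClass _ (arrowPath e)) =
      pathClass (canonicalIdeal I C) (arrowPath (keepArrow C (includeArrow D e) hC)) :=
    congrArg (canonicalIdeal I C).ringCon.mk' (retractAlg_includeAlg_arrow e hC)
  change canonicalInclusion I h (pathClass _ (arrowPath e)) ∈ _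
  rw [key]
  exact TwoSidedIdeal.subset_span ⟨keepArrow C (includeArrow D e) hC, he, rfl⟩

/-- On generators: an arrow of `B` lying in `D` goes to zero, any other one to itself. -/
theorem canonicalProjection_mem_arrowIdeal (hD : PreRemovable I D) (B : Set (Total V)) :
    ∀ x ∈ arrowIdeal (canonicalIdeal I C) (restrictArrows C B),
      canonicalProjection I C hD x ∈ arrowIdeal (canonicalIdeal I D) (restrictArrows D B) := by
  refine arrowIdeal_le_comap (canonicalProjection I C hD).toRingHom fun e he => ?_
  change canonicalProjection I C hD (pathClass _ (arrowPath e)) ∈ _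
  by_cases heD : includeArrow C e ∈ D
  · have key : canonicalProjection I C hD (pathClass _ (arrowPath e)) =
        (canonicalIdeal I D).ringCon.mk' 0 :=
      congrArg (canonicalIdeal I D).ringCon.mk' (retractAlg_includeAlg_arrow_of_mem e heD)
    rw [key, map_zero]
    exact TwoSidedIdeal.zero_mem _
  · have key : canonicalProjection I C hD (pathClass _ (arrowPath e)) =
        pathClass (canonicalIdeal I D) (arrowPath (keepArrow D (includeArrow C e) heD)) :=
      congrArg (canonicalIdeal I D).ringCon.mk' (retractAlg_includeAlg_arrow e heD)
    rw [key]
    exact TwoSidedIdeal.subset_span ⟨keepArrow D (includeArrow C e) heD, he, rfl⟩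

variable {I}

theorem FinitePdLeft.mono (h : C ⊆ D) (hD : PreRemovable I D) {B : Set (Total V)}
    (hB : FinitePdLeft (canonicalIdeal I C) (restrictArrows C B)) :
    FinitePdLeft (canonicalIdeal I D) (restrictArrows D B) :=
  projectiveDimension_lt_top_of_semilinear_retract
    (i := (canonicalInclusion I h).toRingHom) (π := (canonicalProjection I C hD).toRingHom)
    (canonicalProjection_canonicalInclusion I h hD)
    (TwoSidedIdeal.leftSemilinearMap (canonicalInclusion I h).toRingHom
      (canonicalInclusion_mem_arrowIdeal I h B))
    (TwoSidedIdeal.leftSemilinearMap (canonicalProjection I C hD).toRingHom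
      (canonicalProjection_mem_arrowIdeal I hD B))
    (fun x => Subtype.ext (canonicalProjection_canonicalInclusion I h hD x.1)) hB

theorem FinitePdRight.mono (h : C ⊆ D) (hD : PreRemovable I D) {B : Set (Total V)}
    (hB : FinitePdRight (canonicalIdeal I C) (restrictArrows C B)) :
    FinitePdRight (canonicalIdeal I D) (restrictArrows D B) :=
  projectiveDimension_lt_top_of_semilinear_retract
    (i := RingHom.op (canonicalInclusion I h).toRingHom)
    (π := RingHom.op (canonicalProjection I C hD).toRingHom)
    (fun s => MulOpposite.unop_injective (canonicalProjection_canonicalInclusion I h hD s.unop))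
    (TwoSidedIdeal.rightSemilinearMap (canonicalInclusion I h).toRingHom
      (canonicalInclusion_mem_arrowIdeal I h B))
    (TwoSidedIdeal.rightSemilinearMap (canonicalProjection I C hD).toRingHom
      (canonicalProjection_mem_arrowIdeal I hD B))
    (fun x => Subtype.ext (canonicalProjection_canonicalInclusion I h hD x.1)) hB

/-- The word "only" in the one-sided case is immaterial: if the left dimension is finite too, the
set is two-sided removable. -/
theorem removable_iff {J : TwoSidedIdeal (PathAlgebra k V)} {A : Set (Total V)} :
    Removable J A ↔ PreRemovable J A ∧ FinitePdRight J A ∧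
      (FinitePdLeft J A ∨ ∀ x ∈ arrowIdeal J A, ∀ y ∈ arrowIdeal J A, x * y = 0) := by
  unfold Removable TwoSidedRemovable OnlyLeftRemovable NonRepetitive
  tauto

theorem Removable.mono (h : C ⊆ D) (hD : PreRemovable I D) {B : Set (Total V)}
    (hDB : PreRemovable I (D ∪ B)) (hB : Removable (canonicalIdeal I C) (restrictArrows C B)) :
    Removable (canonicalIdeal I D) (restrictArrows D B) := by
  rw [removable_iff] at *
  refine ⟨hDB.restrictArrows, hB.2.1.mono h hD, hB.2.2.imp (FinitePdLeft.mono h hD) ?_⟩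
  intro h0 x hx y hy
  rw [← canonicalProjection_canonicalInclusion I h hD x,
    ← canonicalProjection_canonicalInclusion I h hD y, ← map_mul,
    h0 _ (canonicalInclusion_mem_arrowIdeal I h B x hx) _
      (canonicalInclusion_mem_arrowIdeal I h B y hy), map_zero]

end Comparison

end BoundQuiver

end

noncomputable section

namespace BoundQuiver

/-! ### Eventually removable sets and their unions -/

open PathAlgebra

variable {k : Type u} [Field k] {V : Type v} [Quiver.{w + 1} V] [Fintype V]

theorem eventuallyRemovable_empty (I : TwoSidedIdeal (PathAlgebra k V)) :
    EventuallyRemovable I (∅ : Set (Total V)) :=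
  ⟨0, fun _ => ∅, fun i => i.elim0, by simp, fun i => i.elim0⟩

theorem EventuallyRemovable.union_of_removable {I : TwoSidedIdeal (PathAlgebra k V)}
    {A B : Set (Total V)} (hA : EventuallyRemovable I A)
    (hB : Removable (canonicalIdeal I A) (restrictArrows A B)) :
    EventuallyRemovable I (A ∪ B) := by
  obtain ⟨m, P, hd, hP, hr⟩ := hA
  have hsub : ∀ i, P i ⊆ A := fun i => hP ▸ Set.subset_iUnion P i
  -- The new block is `B \ A` to keep the blocks disjoint; after deleting `A` it restricts to the
  -- same arrows as `B`.
  let P' : Fin (m + 1) → Set (Total V) := Fin.snoc (α := fun _ => Set (Total V)) P (B \ A)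
  have hc : ∀ i, P' (Fin.castSucc i) = P i := fun i => Fin.snoc_castSucc (α := fun _ => _) _ _ i
  have hl : P' (Fin.last m) = B \ A := Fin.snoc_last (α := fun _ => _) _ _
  have hdis : ∀ i, Disjoint (P i) (B \ A) := fun i =>
    Set.disjoint_sdiff_right.mono_left (hsub i)
  refine ⟨m + 1, P', ?_, ?_, ?_⟩
  · intro i j hij
    rw [Function.onFun]
    induction i using Fin.lastCases with
    | last =>
      induction j using Fin.lastCases with
      | last => exact absurd rfl hij
      | cast j =>
        rw [hc, hl]
        exact (hdis j).symm
    | cast i =>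
      induction j using Fin.lastCases with
      | last =>
        rw [hc, hl]
        exact hdis i
      | cast j =>
        rw [hc, hc]
        exact hd fun h => hij (congrArg _ h)
  · rw [← Set.union_sdiff_self]
    ext e
    simp only [Set.mem_iUnion, Set.mem_union, Fin.exists_fin_succ', hc, hl, ← hP]
  · intro j
    induction j using Fin.lastCases with
    | last =>
      have hU : ⋃ i < Fin.last m, P' i = A := by
        rw [← hP]
        ext e
        simp [Fin.exists_fin_succ', hc]
      rw [hU, hl, restrictArrows_diff_self]
      exact hB
    | cast j =>
      have hU : ⋃ i < Fin.castSucc j, P' i = ⋃ i < j, P i := by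
        ext e
        simp [Fin.exists_fin_succ', hc, (Fin.castSucc_lt_last j).not_gt]
      rw [hU, hc]
      exact hr j

/-- Builds `A` block by block through the unions of initial segments of the partition. -/
theorem EventuallyRemovable.induction_on {I : TwoSidedIdeal (PathAlgebra k V)}
    {M : Set (Total V) → Prop} {A : Set (Total V)} (hA : EventuallyRemovable I A) (empty : M ∅)
    (union : ∀ C B, M C → Removable (canonicalIdeal I C) (restrictArrows C B) → M (C ∪ B)) :
    M A := by
  obtain ⟨m, P, -, hP, hr⟩ := hA
  have key : ∀ n ≤ m, M (⋃ (i : Fin m) (_ : i.1 < n), P i) := by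
    intro n
    induction n with
    | zero => simpa using empty
    | succ n ih =>
      intro hn
      have h : ⋃ (i : Fin m) (_ : i.1 < n + 1), P i =
          (⋃ (i : Fin m) (_ : i.1 < n), P i) ∪ P ⟨n, hn⟩ := by
        ext e
        simp only [Set.mem_iUnion, Set.mem_union, exists_prop]
        constructor
        · rintro ⟨i, hi, he⟩
          rcases Nat.lt_succ_iff_lt_or_eq.1 hi with hi | rfl
          · exact Or.inl ⟨i, hi, he⟩
          · exact Or.inr he
        · rintro (⟨i, hi, he⟩ | he)
          · exact ⟨i, hi.trans (Nat.lt_succ_self n), he⟩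
          · exact ⟨⟨n, hn⟩, Nat.lt_succ_self n, he⟩
      rw [h]
      exact union _ _ (ih (Nat.le_of_succ_le hn)) (hr ⟨n, hn⟩)
  have h := key m le_rfl
  simp only [Fin.is_lt, Set.iUnion_true, hP] at h
  exact h

theorem EventuallyRemovable.preRemovable {I : TwoSidedIdeal (PathAlgebra k V)}
    {A : Set (Total V)} (hA : EventuallyRemovable I A) : PreRemovable I A :=
  hA.induction_on (preRemovable_empty I) fun _ _ hC hB =>
    hC.union_of_restrictArrows (removable_iff.1 hB).1

theorem EventuallyRemovable.union {I : TwoSidedIdeal (PathAlgebra k V)} {A B : Set (Total V)}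
    (hA : EventuallyRemovable I A) (hB : EventuallyRemovable I B) :
    EventuallyRemovable I (A ∪ B) := by
  -- Pre-removability of `C` is carried along because `Removable.mono` needs it for `A ∪ C ∪ D`,
  -- where it comes from `A` and `C ∪ D`.
  refine (hB.induction_on (M := fun C => PreRemovable I C ∧ EventuallyRemovable I (A ∪ C))
    ⟨preRemovable_empty I, by rwa [Set.union_empty]⟩ ?_).2
  rintro C D ⟨hC, hAC⟩ hD
  have hCD := hC.union_of_restrictArrows (removable_iff.1 hD).1
  refine ⟨hCD, ?_⟩
  rw [← Set.union_assoc]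
  refine hAC.union_of_removable (hD.mono Set.subset_union_right hAC.preRemovable ?_)
  rw [Set.union_assoc]
  exact hA.preRemovable.union hCD

theorem existsUnique_maximal_eventuallyRemovable [Finite (Total V)]
    (I : TwoSidedIdeal (PathAlgebra k V)) :
    ∃! A : Set (Total V), Maximal (EventuallyRemovable I) A := by
  obtain ⟨A, hA⟩ := (Set.toFinite {A | EventuallyRemovable I A}).exists_maximal
    ⟨∅, eventuallyRemovable_empty I⟩
  refine ⟨A, hA, fun B hB => ?_⟩
  have h : EventuallyRemovable I (A ∪ B) := EventuallyRemovable.union hA.prop hB.prop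
  exact (hB.eq_of_subset h Set.subset_union_right).trans
    (hA.eq_of_subset h Set.subset_union_left).symm

theorem IsAdmissible.canonicalIdeal {I : TwoSidedIdeal (PathAlgebra k V)} (hI : IsAdmissible I)
    (A : Set (Total V)) : IsAdmissible (canonicalIdeal I A) := by
  obtain ⟨⟨m, hm⟩, h2⟩ := hI
  refine ⟨⟨m, fun p hp => ?_⟩, fun z hz p hp => ?_⟩
  · rw [mem_canonicalIdeal, includeAlg, AlgHom.ofLinearMap_apply, includeLin_ofPath]
    exact hm _ (hp.trans_eq (length_includePath A p).symm)
  · rw [← length_includePath]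
    refine h2 _ (mem_canonicalIdeal.1 hz) _ ?_
    rwa [includeAlg, AlgHom.ofLinearMap_apply, coeffs_includeLin]

/-! ### The isomorphism between `kQ'/I'` and `Λ/⟨A + I⟩` -/

section Representation

variable (I : TwoSidedIdeal (PathAlgebra k V)) (A : Set (Total V))

/-- The homomorphism `k Q' / I' → Λ / ⟨A + I⟩` induced by the inclusion `k Q' → k Q`. -/
def canonicalRepresentation :
    BQA (canonicalIdeal I A) →ₐ[k] (arrowIdeal I A).ringCon.Quotient :=
  ((arrowIdeal I A).ringCon.mkₐ k).comp
    (TwoSidedIdeal.quotientMapₐ (canonicalIdeal I A) I (includeAlg A)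
      fun _ hx => mem_canonicalIdeal.1 hx)

theorem canonicalRepresentation_pathClass (p : QPath (removeArrows A)) :
    canonicalRepresentation I A (pathClass (canonicalIdeal I A) p) =
      (arrowIdeal I A).ringCon.mk' (pathClass I (includePath A p)) :=
  congrArg (fun z => (arrowIdeal I A).ringCon.mk' (I.ringCon.mk' z)) (includeLin_ofPath A p)

variable {I A}

/-- If `A` is pre-removable, then the projection `k Q → k Q'` induces a homomorphism
`k Q / I → k Q' / I'`. -/
def projectionOfPreRemovable (hA : PreRemovable I A) : BQA I →ₐ[k] BQA (canonicalIdeal I A) :=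
  TwoSidedIdeal.quotientMapₐ I (canonicalIdeal I A) (retractAlg A) fun z hz => by
    rw [mem_canonicalIdeal, includeAlg_retractAlg]
    exact preRemovable_iff.1 hA z hz

theorem projectionOfPreRemovable_eq_zero (hA : PreRemovable I A) :
    ∀ x ∈ arrowIdeal I A, projectionOfPreRemovable hA x = 0 := by
  intro x hx
  have h := arrowIdeal_le_comap (J := ⊥) (projectionOfPreRemovable hA).toRingHom (A := A)
    (fun e he => ?_) x hx
  · exact (TwoSidedIdeal.mem_bot _).1 h
  · refine (TwoSidedIdeal.mem_bot _).2 ?_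
    exact (congrArg (canonicalIdeal I A).ringCon.mk'
      (retractLin_ofPath_of_passesThrough ((passesThrough_toPath A e).2 he))).trans (map_zero _)

/-- Pre-removability gives a projection from `Λ` to `kQ'/I'` that kills `⟨A + I⟩` and undoes the
inclusion. -/
theorem canonicalRepresentation_injective (hA : PreRemovable I A) :
    Function.Injective (canonicalRepresentation I A) := by
  rw [injective_iff_map_eq_zero]
  intro x hx
  obtain ⟨x, rfl⟩ := RingCon.mk'_surjective _ x
  have h := (TwoSidedIdeal.mk'_eq_zero_iff (arrowIdeal I A) (I.ringCon.mk' (includeAlg A x))).1 hx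
  have h0 := projectionOfPreRemovable_eq_zero hA _ h
  rw [projectionOfPreRemovable, TwoSidedIdeal.quotientMapₐ_mk', retractAlg_includeAlg] at h0
  exact h0

theorem mk'_pathClass_eq_zero {p : QPath V} (hp : PassesThrough A p) :
    (arrowIdeal I A).ringCon.mk' (pathClass I p) = 0 := by
  obtain ⟨e, he, p₁, p₂, h⟩ := hp
  obtain ⟨a, b, p⟩ := p
  simp only at p₁ p₂ h
  subst h
  rw [TwoSidedIdeal.mk'_eq_zero_iff, pathClass, ← ofPath_comp, ← ofPath_comp, map_mul, map_mul]
  exact TwoSidedIdeal.mul_mem_right _ _ _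
    (TwoSidedIdeal.mul_mem_left _ _ _ (TwoSidedIdeal.subset_span ⟨e, he, rfl⟩))

/-- The classes of paths span the target; those through `A` vanish and the others come from `Q'`.
This holds for every `A`. -/
theorem canonicalRepresentation_surjective (I : TwoSidedIdeal (PathAlgebra k V))
    (A : Set (Total V)) : Function.Surjective (canonicalRepresentation I A) := by
  intro y
  obtain ⟨y, rfl⟩ := RingCon.mk'_surjective _ y
  obtain ⟨z, rfl⟩ := RingCon.mk'_surjective _ y
  let f : PathAlgebra k V →ₐ[k] (arrowIdeal I A).ringCon.Quotient :=
    ((arrowIdeal I A).ringCon.mkₐ k).comp (I.ringCon.mkₐ k)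
  suffices h : f z ∈ (canonicalRepresentation I A).range from h
  induction z using PathAlgebra.induction_on with
  | zero => rw [map_zero]; exact zero_mem _
  | add x y hx hy => rw [map_add]; exact add_mem hx hy
  | smul c p =>
    rw [map_smul]
    refine Subalgebra.smul_mem _ ?_ c
    by_cases hp : PassesThrough A p
    · have h : f (ofPath p) = 0 := mk'_pathClass_eq_zero hp
      rw [h]
      exact zero_mem _
    · obtain ⟨q, rfl⟩ := (range_includePath A p).2 hp
      exact ⟨_, canonicalRepresentation_pathClass I A q⟩

/-- If `A` is pre-removable, then the canonical representation `k Q' / I'` is isomorphic to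
`Λ / ⟨A + I⟩`. -/
def canonicalRepresentationEquiv (hA : PreRemovable I A) :
    BQA (canonicalIdeal I A) ≃ₐ[k] (arrowIdeal I A).ringCon.Quotient :=
  AlgEquiv.ofBijective (canonicalRepresentation I A)
    ⟨canonicalRepresentation_injective hA, canonicalRepresentation_surjective I A⟩

end Representation

end BoundQuiver

end

theorem mainTheorem3 {k : Type u} [Field k] {V : Type v} [Fintype V] [Quiver.{w + 1} V]
    [Finite (Quiver.Total V)] (I : TwoSidedIdeal (BoundQuiver.PathAlgebra k V))
    (hI : BoundQuiver.IsAdmissible I) :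
    (∃! A : Set (Quiver.Total V), Maximal (BoundQuiver.EventuallyRemovable I) A) ∧
    ∀ A : Set (Quiver.Total V), Maximal (BoundQuiver.EventuallyRemovable I) A →
      BoundQuiver.PreRemovable I A ∧
      BoundQuiver.IsAdmissible (BoundQuiver.canonicalIdeal I A) ∧
      ∃ φ : BoundQuiver.BQA (BoundQuiver.canonicalIdeal I A) ≃ₐ[k]
          (BoundQuiver.arrowIdeal I A).ringCon.Quotient,
        ∀ p : BoundQuiver.QPath (BoundQuiver.removeArrows A),
          φ (BoundQuiver.pathClass (BoundQuiver.canonicalIdeal I A) p) =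
            (BoundQuiver.arrowIdeal I A).ringCon.mk'
              (BoundQuiver.pathClass I (BoundQuiver.includePath A p)) :=
  ⟨BoundQuiver.existsUnique_maximal_eventuallyRemovable I, fun A hA =>
    ⟨hA.prop.preRemovable, hI.canonicalIdeal A,
      BoundQuiver.canonicalRepresentationEquiv hA.prop.preRemovable,
      BoundQuiver.canonicalRepresentation_pathClass I A⟩⟩
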